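/- Let $M$ be a (Hausdorff) CW-complex with finite $1$-skeleton and let $p:F\to M$ be a connected Galois cover with finite Galois group $C$, that is, $F$ is connected, $C$ acts on $F$ by deck transformations, freely, properly discontinuously and transitively on each fibre of $p$, and $p$ induces a homeomorphism $F/C\cong M$. Let $\mathbb{K}$ be a field of characteristic zero. For a topological space $X$ with base point $x_0$, and integers $i\ge 0$, $m>0$, put $$\mathcal V^i_m(X,\mathbb K)=\{\rho\in \mathrm{Hom}(\pi_1(X,x_0),\mathbb K^{*})\mid \dim_{\mathbb K}H^i(X,\mathcal L_\rho)\ge m\},$$ where $\mathcal L_\rho$ is the rank one local system on $X$ with monodromy character $\rho$, and $$\mathcal R^i_m(X,\mathbb K)=\{\alpha\in H^1(X,\mathbb K)\mid \dim_{\mathbb K}H^i(H^{\bullet}(X,\mathbb K),\mu_\alpha)\ge m\},$$ where $\mu_\alpha:H^{n}(X,\mathbb K)\to H^{n+1}(X,\mathbb K)$ is right multiplication by $\alpha$ in the cohomology ring of $X$. (Dimensions may be infinite.) Then, for all $i\ge 0$ and $m>0$, $$p^*(\mathcal V^i_m(M,\mathbb K))\subseteq \mathcal V^i_m(F,\mathbb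 K)\quad\text{and}\quad p^*(\mathcal R^i_m(M,\mathbb K))\subseteq \mathcal R^i_m(F,\mathbb K),$$ where the first $p^*:\mathrm{Hom}(\pi_1(M,p(y_0)),\mathbb K^*)\to\mathrm{Hom}(\pi_1(F,y_0),\mathbb K^*)$ is composition with $p_*$, for any base point $y_0\in F$, and the second $p^*:H^1(M,\mathbb K)\to H^1(F,\mathbb K)$ is the induced map in cohomology. -/

import Mathlib

noncomputable section

namespace JumpLoci

/-! ## Cohomology of a sequence of linear maps -/

section Complex

variable {K : Type*} [Field K]
  {A : ℕ → Type*} [∀ n, AddCommGroup (A n)] [∀ n, Module K (A n)]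
  {B : ℕ → Type*} [∀ n, AddCommGroup (B n)] [∀ n, Module K (B n)]

/-- The image of the differential `A (n - 1) → A n`; it is `0` for `n = 0`, that is, the complex
`A 0 → A 1 → A 2 → ⋯` is extended by zero to negative degrees. -/
def boundaries (d : ∀ n, A n →ₗ[K] A (n + 1)) : ∀ n, Submodule K (A n)
  | 0 => ⊥
  | n + 1 => LinearMap.range (d n)

/-- The `n`-th cohomology `ker (d n) / im (d (n - 1))` of a cochain complex
`A 0 → A 1 → A 2 → ⋯`. -/
abbrev Cohomology (d : ∀ n, A n →ₗ[K] A (n + 1)) (n : ℕ) : Type _ :=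
  LinearMap.ker (d n) ⧸ (boundaries d n).submoduleOf (LinearMap.ker (d n))

lemma map_mem_boundaries {d : ∀ n, A n →ₗ[K] A (n + 1)} {d' : ∀ n, B n →ₗ[K] B (n + 1)}
    (f : ∀ n, A n →ₗ[K] B n) (hf : ∀ n a, d' n (f n a) = f (n + 1) (d n a)) :
    ∀ (n : ℕ) {a : A n}, a ∈ boundaries d n → f n a ∈ boundaries d' n
  | 0, a, ha => by
      have h0 : a = 0 := ha
      rw [h0, map_zero]
      exact zero_mem _
  | n + 1, _, ⟨b, hb⟩ => ⟨f n b, by rw [hf, hb]⟩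

/-- The linear map induced in cohomology by a map of cochain complexes. -/
def Cohomology.map {d : ∀ n, A n →ₗ[K] A (n + 1)} {d' : ∀ n, B n →ₗ[K] B (n + 1)}
    (f : ∀ n, A n →ₗ[K] B n) (hf : ∀ n a, d' n (f n a) = f (n + 1) (d n a)) (n : ℕ) :
    Cohomology d n →ₗ[K] Cohomology d' n :=
  Submodule.mapQ _ _
    ((f n).restrict (p := LinearMap.ker (d n)) (q := LinearMap.ker (d' n)) fun a ha => by
      rw [LinearMap.mem_ker] at ha ⊢
      rw [hf, ha, map_zero])
    (fun _ ha => map_mem_boundaries f hf n ha)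

end Complex

/-! ## Singular simplices -/

section Simplices

variable {X Y : Type*} [TopologicalSpace X] [TopologicalSpace Y]

/-- Singular `n`-simplices of `X`: continuous maps from the standard `n`-simplex. -/
abbrev SingularSimplex (X : Type*) [TopologicalSpace X] (n : ℕ) : Type _ :=
  C(stdSimplex ℝ (Fin (n + 1)), X)

/-- The `i`-th vertex of the standard `n`-simplex. -/
abbrev vertex {n : ℕ} (i : Fin (n + 1)) : stdSimplex ℝ (Fin (n + 1)) :=
  stdSimplex.vertex i

/-- The straight path between two points of a standard simplex. -/
def simplexSegment {n : ℕ} (s t : stdSimplex ℝ (Fin (n + 1))) : Path s t where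
  toFun u := ⟨AffineMap.lineMap s.1 t.1 (u : ℝ),
    (convex_stdSimplex ℝ (Fin (n + 1))).lineMap_mem s.2 t.2 u.2⟩
  continuous_toFun := by
    refine Continuous.subtype_mk ?_ _
    simp only [AffineMap.lineMap_apply]
    fun_prop
  source' := by simp
  target' := by simp

/-- The inclusion `k ↦ k` of the first `p + 1` vertices of the `n`-simplex, `n = p + q`. -/
def frontVertex {p q n : ℕ} (h : p + q = n) (k : Fin (p + 1)) : Fin (n + 1) := ⟨k, by omega⟩

/-- The inclusion `k ↦ p + k` of the last `q + 1` vertices of the `n`-simplex, `n = p + q`. -/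
def backVertex {p q n : ℕ} (h : p + q = n) (k : Fin (q + 1)) : Fin (n + 1) := ⟨p + k, by omega⟩

/-- The vertex map `k ↦ k` for `k < i` and `k ↦ k + 1` for `k ≥ i`. -/
def skip {n : ℕ} (i : ℕ) (k : Fin (n + 1)) : Fin (n + 2) :=
  ⟨if (k : ℕ) < i then k else k + 1, by split <;> omega⟩

namespace SingularSimplex

/-- Precompose a singular simplex with the affine map of standard simplices that is given on
vertices by `f`. -/
def reindex {m n : ℕ} (σ : SingularSimplex X n) (f : Fin (m + 1) → Fin (n + 1)) :
    SingularSimplex X m :=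
  ContinuousMap.comp σ ⟨stdSimplex.map f, stdSimplex.continuous_map f⟩

lemma reindex_reindex {l m n : ℕ} (σ : SingularSimplex X n) (f : Fin (m + 1) → Fin (n + 1))
    (g : Fin (l + 1) → Fin (m + 1)) : (σ.reindex f).reindex g = σ.reindex (f ∘ g) := by
  ext t
  simp only [reindex, ContinuousMap.comp_apply, ContinuousMap.coe_mk,
    stdSimplex.map_comp_apply]

/-- The `i`-th face, opposite to the `i`-th vertex. -/
def face {n : ℕ} (σ : SingularSimplex X (n + 1)) (i : Fin (n + 2)) : SingularSimplex X n :=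
  σ.reindex i.succAbove

/-- The front `p`-face of an `n`-simplex, on the vertices `0, …, p`. -/
def front {p q n : ℕ} (h : p + q = n) (σ : SingularSimplex X n) : SingularSimplex X p :=
  σ.reindex (frontVertex h)

/-- The back `q`-face of an `n`-simplex, on the vertices `p, …, n = p + q`. -/
def back {p q n : ℕ} (h : p + q = n) (σ : SingularSimplex X n) : SingularSimplex X q :=
  σ.reindex (backVertex h)

/-- The image under `σ` of the straight path from the first vertex of the standard simplex to
the first vertex of its `i`-th face. It is constant for `i ≠ 0`, and it is the edge of `σ` from
vertex `0` to vertex `1` for `i = 0`. -/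
def facePath {n : ℕ} (σ : SingularSimplex X (n + 1)) (i : Fin (n + 2)) :
    Path (σ (vertex 0)) (σ.face i (vertex 0)) :=
  (simplexSegment (vertex 0) (stdSimplex.map i.succAbove (vertex 0))).map σ.continuous

end SingularSimplex

end Simplices

/-! ## Singular cohomology and its cup product -/

section Singular

variable (K : Type*) [Field K] (X : Type*) [TopologicalSpace X]

/-- Singular `n`-cochains of `X` with coefficients in `K`. -/
abbrev Cochain (n : ℕ) : Type _ := SingularSimplex X n → K

/-- The singular coboundary `(d c)(σ) = ∑ i, (-1)^i c(σ|[0, …, î, …, n + 1])`. -/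
def coboundary (n : ℕ) : Cochain K X n →ₗ[K] Cochain K X (n + 1) where
  toFun c σ := ∑ i : Fin (n + 2), (-1) ^ (i : ℕ) * c (σ.face i)
  map_add' a b := by
    funext σ
    simp [mul_add, Finset.sum_add_distrib]
  map_smul' r a := by
    funext σ
    simp [Finset.mul_sum, mul_left_comm]

/-- Singular cohomology `H^n(X, K)`. -/
abbrev H (n : ℕ) : Type _ := Cohomology (coboundary K X) n

variable {K X}

/-- The cup product of singular cochains:
`(a ∪ b)(σ) = a(σ|[0, …, p]) · b(σ|[p, …, p + q])`. -/
def cupCochain {p q n : ℕ} (h : p + q = n) :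
    Cochain K X p →ₗ[K] Cochain K X q →ₗ[K] Cochain K X n :=
  LinearMap.mk₂ K (fun a b σ => a (σ.front h) * b (σ.back h))
    (fun a a' b => by funext σ; simp [add_mul])
    (fun r a b => by funext σ; simp [mul_assoc])
    (fun a b b' => by funext σ; simp [mul_add])
    (fun r a b => by funext σ; simp [mul_left_comm])

lemma cupCochain_apply {p q n : ℕ} (h : p + q = n) (a : Cochain K X p) (b : Cochain K X q)
    (σ : SingularSimplex X n) : cupCochain h a b σ = a (σ.front h) * b (σ.back h) := rfl

lemma coboundary_apply_range {n : ℕ} (c : Cochain K X n) (σ : SingularSimplex X (n + 1)) :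
    coboundary K X n c σ =
      ∑ i ∈ Finset.range (n + 2), (-1) ^ i * c (σ.reindex (skip i)) := by
  rw [Finset.sum_range fun i => (-1 : K) ^ i * c (σ.reindex (skip i))]
  change ∑ i : Fin (n + 2), (-1 : K) ^ (i : ℕ) * c (σ.face i) = _
  refine Finset.sum_congr rfl fun i _ => ?_
  have h : i.succAbove = skip i := by
    funext k
    apply Fin.ext
    simp only [skip, Fin.succAbove, Fin.lt_def, Fin.val_castSucc]
    split <;> simp
  rw [SingularSimplex.face, h]

/-- The Leibniz rule `d (a ∪ b) = d a ∪ b + (-1)^p a ∪ d b`. -/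
lemma coboundary_cupCochain {p q n : ℕ} (h : p + q = n) (a : Cochain K X p) (b : Cochain K X q) :
    coboundary K X n (cupCochain h a b) =
      cupCochain (by omega : p + 1 + q = n + 1) (coboundary K X p a) b +
        (-1 : K) ^ p • cupCochain (by omega : p + (q + 1) = n + 1) a (coboundary K X q b) := by
  have hl : p + 1 + q = n + 1 := by omega
  have hr : p + (q + 1) = n + 1 := by omega
  have f1 : ∀ i, i ≤ p + 1 → skip i ∘ frontVertex h = frontVertex hl ∘ skip i := by
    intro i _
    funext k
    exact Fin.ext rfl
  have f2 : ∀ i, p + 1 ≤ i → skip i ∘ frontVertex h = frontVertex hr := by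
    intro i hi
    funext k
    apply Fin.ext
    change (if (k : ℕ) < i then (k : ℕ) else k + 1) = k
    split_ifs <;> omega
  have b1 : ∀ i, i ≤ p → skip i ∘ backVertex h = backVertex hl := by
    intro i hi
    funext k
    apply Fin.ext
    change (if p + (k : ℕ) < i then p + (k : ℕ) else p + k + 1) = p + 1 + k
    split_ifs <;> omega
  have b2 : ∀ j, skip (p + j) ∘ backVertex h = backVertex hr ∘ skip j := by
    intro j
    funext k
    apply Fin.ext
    change (if p + (k : ℕ) < p + j then p + (k : ℕ) else p + k + 1) =
      p + if (k : ℕ) < j then (k : ℕ) else k + 1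
    split_ifs <;> omega
  funext σ
  simp only [Pi.add_apply, Pi.smul_apply, smul_eq_mul, cupCochain_apply, coboundary_apply_range,
    SingularSimplex.front, SingularSimplex.back, SingularSimplex.reindex_reindex]
  have split_sum : ∀ f : ℕ → K, ∑ i ∈ Finset.range (n + 2), f i =
      ∑ i ∈ Finset.range (p + 1), f i + ∑ j ∈ Finset.range (q + 1), f (p + (j + 1)) := by
    intro f
    rw [show n + 2 = (p + 1) + (q + 1) by omega, Finset.sum_range_add]
    refine congrArg _ (Finset.sum_congr rfl fun j _ => congrArg f (by omega))
  rw [split_sum, Finset.sum_range_succ _ (p + 1), Finset.sum_range_succ' _ (q + 1), add_mul,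
    mul_add, mul_add, Finset.sum_mul, Finset.mul_sum, Finset.mul_sum]
  have e1 : ∀ i ∈ Finset.range (p + 1),
      (-1 : K) ^ i * (a (σ.reindex (skip i ∘ frontVertex h)) *
        b (σ.reindex (skip i ∘ backVertex h))) =
      (-1) ^ i * a (σ.reindex (frontVertex hl ∘ skip i)) * b (σ.reindex (backVertex hl)) := by
    intro i hi
    rw [Finset.mem_range] at hi
    rw [mul_assoc, f1 i (by omega), b1 i (by omega)]
  have e2 : ∀ j ∈ Finset.range (q + 1),
      (-1 : K) ^ (p + (j + 1)) * (a (σ.reindex (skip (p + (j + 1)) ∘ frontVertex h)) *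
        b (σ.reindex (skip (p + (j + 1)) ∘ backVertex h))) =
      (-1) ^ p * (a (σ.reindex (frontVertex hr)) *
        ((-1) ^ (j + 1) * b (σ.reindex (backVertex hr ∘ skip (j + 1))))) := by
    intro j _
    rw [f2 _ (by omega), b2]
    ring
  have e3 : frontVertex hl ∘ skip (p + 1) = frontVertex hr := by
    rw [← f1 _ le_rfl, f2 _ le_rfl]
  have e4 : backVertex hr ∘ skip 0 = backVertex hl := by
    rw [← b2 0, b1 _ (by omega)]
  rw [Finset.sum_congr rfl e1, Finset.sum_congr rfl e2, e3, e4]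
  ring

lemma cupCochain_mem_boundaries_left {p q n : ℕ} (h : p + q = n) {a : Cochain K X p}
    {b : Cochain K X q} (ha : a ∈ boundaries (coboundary K X) p)
    (hb : b ∈ LinearMap.ker (coboundary K X q)) :
    cupCochain h a b ∈ boundaries (coboundary K X) n := by
  rw [LinearMap.mem_ker] at hb
  cases p with
  | zero =>
    have h0 : a = 0 := ha
    rw [h0, map_zero, LinearMap.zero_apply]
    exact zero_mem _
  | succ p =>
    obtain ⟨e, rfl⟩ := ha
    obtain ⟨n, rfl⟩ : ∃ k, n = k + 1 := ⟨p + q, by omega⟩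
    refine ⟨cupCochain (by omega : p + q = n) e b, ?_⟩
    rw [coboundary_cupCochain, hb, map_zero, smul_zero, add_zero]

lemma cupCochain_mem_boundaries_right {p q n : ℕ} (h : p + q = n) {a : Cochain K X p}
    {b : Cochain K X q} (ha : a ∈ LinearMap.ker (coboundary K X p))
    (hb : b ∈ boundaries (coboundary K X) q) :
    cupCochain h a b ∈ boundaries (coboundary K X) n := by
  rw [LinearMap.mem_ker] at ha
  cases q with
  | zero =>
    have h0 : b = 0 := hb
    rw [h0, map_zero]
    exact zero_mem _
  | succ q =>
    obtain ⟨e, rfl⟩ := hb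
    obtain ⟨n, rfl⟩ : ∃ k, n = k + 1 := ⟨p + q, by omega⟩
    refine ⟨(-1 : K) ^ p • cupCochain (by omega : p + q = n) a e, ?_⟩
    rw [map_smul, coboundary_cupCochain, ha, map_zero, LinearMap.zero_apply, zero_add, smul_smul,
      ← mul_pow]
    simp

/-- The cup product of two cocycles, as a cohomology class. -/
def cupCocycle {p q n : ℕ} (h : p + q = n) :
    LinearMap.ker (coboundary K X p) →ₗ[K] LinearMap.ker (coboundary K X q) →ₗ[K] H K X n :=
  LinearMap.mk₂ K
    (fun a b => Submodule.Quotient.mk ⟨cupCochain h a.1 b.1, by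
      rw [LinearMap.mem_ker, coboundary_cupCochain, LinearMap.mem_ker.mp a.2,
        LinearMap.mem_ker.mp b.2]
      simp⟩)
    (fun a a' b => by
      rw [← Submodule.Quotient.mk_add]; congr 1; apply Subtype.ext; simp)
    (fun r a b => by
      rw [← Submodule.Quotient.mk_smul]; congr 1; apply Subtype.ext; simp)
    (fun a b b' => by
      rw [← Submodule.Quotient.mk_add]; congr 1; apply Subtype.ext; simp)
    (fun r a b => by
      rw [← Submodule.Quotient.mk_smul]; congr 1; apply Subtype.ext; simp)

/-- The cup product `H^p(X, K) × H^q(X, K) → H^n(X, K)`, `n = p + q`: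
`[a] ∪ [b] = [a ∪ b]`. -/
def cup {p q n : ℕ} (h : p + q = n) : H K X p →ₗ[K] H K X q →ₗ[K] H K X n :=
  (Submodule.liftQ _
    (Submodule.liftQ _ (cupCocycle h) (fun a ha => by
      refine LinearMap.ext fun b => ?_
      exact (Submodule.Quotient.mk_eq_zero _).mpr
        (cupCochain_mem_boundaries_left h ha b.2))).flip
    (fun b hb => by
      refine LinearMap.ext fun x => ?_
      obtain ⟨a, rfl⟩ := Submodule.Quotient.mk_surjective _ x
      exact (Submodule.Quotient.mk_eq_zero _).mpr
        (cupCochain_mem_boundaries_right h a.2 hb))).flip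

lemma cup_mk_mk {p q n : ℕ} (h : p + q = n) (a : LinearMap.ker (coboundary K X p))
    (b : LinearMap.ker (coboundary K X q)) :
    cup h (Submodule.Quotient.mk a) (Submodule.Quotient.mk b) = cupCocycle h a b := rfl

variable (K) in
/-- The map `f^* : H^n(Y, K) → H^n(X, K)` induced by a continuous map `f : X → Y`. -/
def pullback {Y : Type*} [TopologicalSpace Y] (f : C(X, Y)) (n : ℕ) : H K Y n →ₗ[K] H K X n :=
  Cohomology.map (fun n => LinearMap.funLeft K K fun σ : SingularSimplex X n => f.comp σ)
    (fun _ _ => rfl) n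

/-- Right multiplication by `α ∈ H^1(X, K)` in the cohomology ring, `x ↦ x ∪ α`. -/
def rightMul (α : H K X 1) (n : ℕ) : H K X n →ₗ[K] H K X (n + 1) :=
  (cup (rfl : n + 1 = n + 1)).flip α

variable (K X) in
/-- The resonance variety `R^i_m(X, K)`: all `α ∈ H^1(X, K)` such that the cohomology in degree
`i` of the complex `(H^•(X, K), · ∪ α)` has dimension at least `m`. -/
def resonanceVariety (i m : ℕ) : Set (H K X 1) :=
  {α | (m : Cardinal) ≤ Module.rank K (Cohomology (rightMul α) i)}

end Singular

/-! ## Cohomology with coefficients in a rank one local system -/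

section Twisted

variable {K : Type*} [Field K] {X : Type*} [TopologicalSpace X]

/-- Singular `n`-cochains of `X` with coefficients in the rank one local system given by a
character `ρ` of the fundamental group. The fibre of this local system at `x` is the space of
functions `f` on the homotopy classes of paths from `x₀` to `x` (the points over `x` in the
universal cover) such that `f (δ · γ) = ρ(δ) f(γ)` for all loops `δ` at `x₀`; a cochain assigns to
each singular simplex an element of the fibre at its first vertex. Equivalently, a cochain is a
`π₁`-equivariant homomorphism from the singular chains of the universal cover to the
one-dimensional representation `K_ρ`. -/
def twistedCochains {x₀ : X} (ρ : FundamentalGroup X x₀ →* Kˣ) (n : ℕ) :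
    Submodule K (∀ σ : SingularSimplex X n,
      Path.Homotopic.Quotient x₀ (σ (vertex 0)) → K) where
  carrier := {c | ∀ (σ : SingularSimplex X n) (δ : Path.Homotopic.Quotient x₀ x₀)
    (γ : Path.Homotopic.Quotient x₀ (σ (vertex 0))),
      c σ (δ.trans γ) = (ρ (FundamentalGroup.fromPath δ) : K) * c σ γ}
  add_mem' ha hb σ δ γ := by simp only [Pi.add_apply, ha σ δ γ, hb σ δ γ, mul_add]
  zero_mem' σ δ γ := by simp
  smul_mem' r c hc σ δ γ := by
    simp only [Pi.smul_apply, smul_eq_mul, hc σ δ γ, mul_left_comm]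

/-- The coboundary with coefficients in a local system: the alternating sum of the values on the
faces, transported to the first vertex of `σ` inside the simplex. -/
def twistedCoboundary {x₀ : X} (ρ : FundamentalGroup X x₀ →* Kˣ) (n : ℕ) :
    twistedCochains ρ n →ₗ[K] twistedCochains ρ (n + 1) where
  toFun c := ⟨fun σ γ => ∑ i : Fin (n + 2), (-1) ^ (i : ℕ) *
      c.1 (σ.face i) (γ.trans (Path.Homotopic.Quotient.mk (σ.facePath i))), by
    intro σ δ γ
    rw [Finset.mul_sum]
    refine Finset.sum_congr rfl fun i _ => ?_
    rw [Path.Homotopic.Quotient.trans_assoc, c.2 (σ.face i), mul_left_comm]⟩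
  map_add' a b := by
    apply Subtype.ext
    funext σ γ
    simp [mul_add, Finset.sum_add_distrib]
  map_smul' r a := by
    apply Subtype.ext
    funext σ γ
    simp [Finset.mul_sum, mul_left_comm]

/-- The cohomology `H^n(X, L_ρ)` with coefficients in the rank one local system of `ρ`. -/
abbrev TwistedH {x₀ : X} (ρ : FundamentalGroup X x₀ →* Kˣ) (n : ℕ) : Type _ :=
  Cohomology (twistedCoboundary ρ) n

variable (K) in
/-- The characteristic variety `V^i_m(X, K)`: all characters `ρ` in `Hom(π₁(X, x₀), K^×)` with
`dim H^i(X, L_ρ) ≥ m`. -/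
def characteristicVariety (x₀ : X) (i m : ℕ) : Set (FundamentalGroup X x₀ →* Kˣ) :=
  {ρ | (m : Cardinal) ≤ Module.rank K (TwistedH ρ i)}

variable (K) in
/-- The map `f^* : Hom(π₁(Y, f x₀), K^×) → Hom(π₁(X, x₀), K^×)` of a continuous map
`f : X → Y`. -/
def characterPullback {Y : Type*} [TopologicalSpace Y] (f : C(X, Y)) (x₀ : X)
    (ρ : FundamentalGroup Y (f x₀) →* Kˣ) : FundamentalGroup X x₀ →* Kˣ :=
  ρ.comp (FundamentalGroup.map f x₀)

end Twisted

end JumpLoci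

end

noncomputable section

namespace JumpLoci

/-! ## Complexes that are retracts up to a nonzero scalar -/

section Complex

variable {K : Type*} [Field K]
  {A : ℕ → Type*} [∀ n, AddCommGroup (A n)] [∀ n, Module K (A n)]
  {B : ℕ → Type*} [∀ n, AddCommGroup (B n)] [∀ n, Module K (B n)]
  {d : ∀ n, A n →ₗ[K] A (n + 1)} {d' : ∀ n, B n →ₗ[K] B (n + 1)}

/-! The proof is a transfer argument. A simplex of `M` has finitely many lifts to `F`, and summing a
cochain over them gives a map `tr` back from cochains of `F` to cochains of `M`. It is a chain map
because lifts of a simplex restrict bijectively to lifts of each face (`Lifts.reindex_bijective`).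
The composite `tr ∘ p^*` is multiplication by a positive integer, invertible in characteristic zero,
so cohomology of `M` embeds in that of `F` (`natCast_le_rank_cohomology`). For resonance, this is
applied to the complexes formed by cohomology with multiplication by `α` and by `p^* α`: `p^*` is a
chain map since it is multiplicative, `tr` by the projection formula `transfer_cup_pullback`, and
the integer is the order of `G`. For characteristic varieties, a value of a twisted cochain on paths
of `F` must first be extended `ρ`-equivariantly to paths of `M` (`extend`). Lifts outside the path
component of `y₀` contribute zero, so the integer in `twistedTransfer_twistedPullback` is the order
of the stabilizer of that component. -/

lemma Cohomology.map_comp_eq_smul (f : ∀ n, A n →ₗ[K] B n)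
    (hf : ∀ n a, d' n (f n a) = f (n + 1) (d n a)) (g : ∀ n, B n →ₗ[K] A n)
    (hg : ∀ n b, d n (g n b) = g (n + 1) (d' n b)) (N : K) (h : ∀ n a, g n (f n a) = N • a)
    (n : ℕ) (x : Cohomology d n) :
    Cohomology.map g hg n (Cohomology.map f hf n x) = N • x := by
  obtain ⟨a, rfl⟩ := Submodule.Quotient.mk_surjective _ x
  rw [← Submodule.Quotient.mk_smul]
  exact congrArg Submodule.Quotient.mk (Subtype.ext (h n a.1))

/-- If a cochain complex is a retract of another one up to a nonzero scalar, then its cohomology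
embeds. -/
lemma natCast_le_rank_cohomology (f : ∀ n, A n →ₗ[K] B n)
    (hf : ∀ n a, d' n (f n a) = f (n + 1) (d n a)) (g : ∀ n, B n →ₗ[K] A n)
    (hg : ∀ n b, d n (g n b) = g (n + 1) (d' n b)) {N : K} (hN : N ≠ 0)
    (h : ∀ n a, g n (f n a) = N • a) {n m : ℕ}
    (hm : (m : Cardinal) ≤ Module.rank K (Cohomology d n)) :
    (m : Cardinal) ≤ Module.rank K (Cohomology d' n) := by
  have inj : Function.Injective (Cohomology.map f hf n) := fun x y hxy => by
    have := congrArg (Cohomology.map g hg n) hxy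
    rw [Cohomology.map_comp_eq_smul f hf g hg N h, Cohomology.map_comp_eq_smul f hf g hg N h] at this
    exact smul_right_injective _ hN this
  have := LinearMap.lift_rank_le_of_injective _ inj
  -- The two cohomology spaces may live in different universes; bounds by a natural number are
  -- insensitive to lifting the rank.
  rw [← Cardinal.nat_le_lift_iff] at hm ⊢
  exact hm.trans this

end Complex

/-! ## Lifts of singular simplices -/

section Lifts

variable {F M : Type*} [TopologicalSpace F] [TopologicalSpace M]

/-- The lifts of a singular simplex along `p`. -/
abbrev Lifts (p : C(F, M)) {n : ℕ} (σ : SingularSimplex M n) : Type _ :=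
  {τ : SingularSimplex F n // p.comp τ = σ}

variable {p : C(F, M)}

lemma Lifts.apply_eq {n : ℕ} {σ : SingularSimplex M n} (τ : Lifts p σ)
    (s : stdSimplex ℝ (Fin (n + 1))) : p (τ.1 s) = σ s :=
  DFunLike.congr_fun τ.2 s

/-- The point of the fibre over `σ s` given by a lift of `σ`. -/
def Lifts.eval {n : ℕ} (σ : SingularSimplex M n) (s : stdSimplex ℝ (Fin (n + 1)))
    (τ : Lifts p σ) : p ⁻¹' {σ s} :=
  ⟨τ.1 s, τ.apply_eq s⟩

/-- Restriction of the lifts of `σ` to the affine subsimplex `f`. -/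
def Lifts.reindex {k n : ℕ} (σ : SingularSimplex M n) (f : Fin (k + 1) → Fin (n + 1))
    (τ : Lifts p σ) : Lifts p (σ.reindex f) :=
  ⟨τ.1.reindex f, congrArg (SingularSimplex.reindex · f) τ.2⟩

/-- Over a covering map, lifts of a simplex correspond to the points over any of its points. -/
lemma Lifts.eval_bijective (hp : IsCoveringMap p) {n : ℕ} (σ : SingularSimplex M n)
    (s : stdSimplex ℝ (Fin (n + 1))) :
    Function.Bijective (Lifts.eval (p := p) σ s) := by
  constructor
  · intro τ τ' h
    refine Subtype.ext (DFunLike.coe_injective ?_)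
    exact hp.eq_of_comp_eq τ.1.continuous τ'.1.continuous
      (funext fun t => (τ.apply_eq t).trans (τ'.apply_eq t).symm) s (congrArg Subtype.val h)
  · rintro ⟨y, hy⟩
    -- Straight-line contraction to `s`: `σ ∘ c` is a homotopy from the constant map at `σ s` to
    -- `σ`. Lifting it from the constant map at `y` yields, at time 1, a lift of `σ`.
    let c : C(unitInterval × stdSimplex ℝ (Fin (n + 1)), stdSimplex ℝ (Fin (n + 1))) :=
      ⟨fun u => ⟨AffineMap.lineMap s.1 u.2.1 (u.1 : ℝ),
        (convex_stdSimplex ℝ (Fin (n + 1))).lineMap_mem s.2 u.2.2 u.1.2⟩, by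
        refine Continuous.subtype_mk ?_ _
        simp only [AffineMap.lineMap_apply]
        fun_prop⟩
    have c0 : ∀ t, c (0, t) = s := fun t => Subtype.ext (by simp [c])
    have c1 : ∀ t, c (1, t) = t := fun t => Subtype.ext (by simp [c])
    have cs : ∀ u, c (u, s) = s := fun u => Subtype.ext (by simp [c])
    have h0 : ∀ t, σ.comp c (0, t) = p (ContinuousMap.const _ y t) := fun t => by
      simpa [c0] using hy.symm
    let Φ := hp.liftHomotopy (σ.comp c) (ContinuousMap.const _ y) h0
    have hΦ : ∀ u, p (Φ u) = σ (c u) := congr_fun (hp.liftHomotopy_lifts (σ.comp c) _ h0)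
    refine ⟨⟨⟨fun t => Φ (1, t), by fun_prop⟩, ?_⟩, Subtype.ext ?_⟩
    · ext t
      simpa [c1] using hΦ (1, t)
    -- The contraction fixes `s`, so `u ↦ Φ (u, s)` lifts a constant path and is constant.
    · have : Φ (1, s) = Φ (0, s) := hp.const_of_comp (g := fun u : unitInterval => Φ (u, s)) (by fun_prop)
        (fun u v => by simp only [hΦ, cs]) 1 0
      exact this.trans (hp.liftHomotopy_zero (σ.comp c) _ h0 s)

/-- Restricting a lift and then evaluating at vertex 0 is evaluation at the image of that vertex;
both evaluations are bijective, hence so is the restriction. -/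
lemma Lifts.reindex_bijective (hp : IsCoveringMap p) {k n : ℕ} (σ : SingularSimplex M n)
    (f : Fin (k + 1) → Fin (n + 1)) : Function.Bijective (Lifts.reindex (p := p) σ f) := by
  have h := Lifts.eval_bijective hp (σ.reindex f) (vertex 0)
  exact (Function.Bijective.of_comp_iff' h _).mp
    (Lifts.eval_bijective hp σ (stdSimplex.map f (vertex 0)))

lemma Lifts.sum_reindex [∀ n (σ : SingularSimplex M n), Fintype (Lifts p σ)]
    (hp : IsCoveringMap p) {R : Type*} [AddCommMonoid R] {k n : ℕ} (σ : SingularSimplex M n)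
    (f : Fin (k + 1) → Fin (n + 1)) (u : Lifts p (σ.reindex f) → R) :
    ∑ τ, u τ = ∑ τ : Lifts p σ, u (τ.reindex σ f) :=
  ((Lifts.reindex_bijective hp σ f).sum_comp u).symm

/-- The action of the deck group on one lift yields all lifts. -/
def Lifts.equivGroup {G : Type*} [Group G] [MulAction G F] (hp : IsQuotientCoveringMap p G)
    {n : ℕ} (σ : SingularSimplex M n) (e : p ⁻¹' {σ (vertex 0)}) : Lifts p σ ≃ G :=
  (Equiv.ofBijective _ (Lifts.eval_bijective hp.isCoveringMap σ (vertex 0))).trans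
    (hp.fiberEquivGroup e)

lemma Lifts.equivGroup_smul {G : Type*} [Group G] [MulAction G F]
    (hp : IsQuotientCoveringMap p G) {n : ℕ} (σ : SingularSimplex M n)
    (e : p ⁻¹' {σ (vertex 0)}) (τ : Lifts p σ) :
    Lifts.equivGroup hp σ e τ • (e : F) = τ.1 (vertex 0) :=
  hp.fiberEquivGroup_smul_self e (e' := Lifts.eval σ (vertex 0) τ)

end Lifts

/-! ## Transfer in singular cohomology -/

section Transfer

variable {F M : Type*} [TopologicalSpace F] [TopologicalSpace M] {K : Type*} [Field K]

variable (K) in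
/-- The transfer of singular cochains: sum over all lifts. -/
def transferCochain (p : C(F, M)) [∀ n (σ : SingularSimplex M n), Fintype (Lifts p σ)] (n : ℕ) :
    Cochain K F n →ₗ[K] Cochain K M n where
  toFun c σ := ∑ τ : Lifts p σ, c τ.1
  map_add' a b := by
    funext σ
    simp [Finset.sum_add_distrib]
  map_smul' r a := by
    funext σ
    simp [Finset.mul_sum]

variable {p : C(F, M)} [∀ n (σ : SingularSimplex M n), Fintype (Lifts p σ)]

lemma transferCochain_reindex (hp : IsCoveringMap p) {k n : ℕ} (c : Cochain K F k)
    (σ : SingularSimplex M n) (f : Fin (k + 1) → Fin (n + 1)) :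
    transferCochain K p k c (σ.reindex f) = ∑ τ : Lifts p σ, c (τ.1.reindex f) :=
  Lifts.sum_reindex hp σ f fun τ => c τ.1

lemma coboundary_transferCochain (hp : IsCoveringMap p) (n : ℕ) (c : Cochain K F n) :
    coboundary K M n (transferCochain K p n c) =
      transferCochain K p (n + 1) (coboundary K F n c) := by
  funext σ
  change ∑ i : Fin (n + 2), (-1 : K) ^ (i : ℕ) * transferCochain K p n c (σ.reindex i.succAbove) =
    ∑ τ : Lifts p σ, ∑ i : Fin (n + 2), (-1 : K) ^ (i : ℕ) * c (τ.1.reindex i.succAbove)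
  rw [Finset.sum_comm]
  refine Finset.sum_congr rfl fun i _ => ?_
  rw [transferCochain_reindex hp, Finset.mul_sum]

variable (K) in
/-- The transfer `H^n(F, K) → H^n(M, K)` of a covering map with finite fibres. -/
def transfer (hp : IsCoveringMap p) (n : ℕ) : H K F n →ₗ[K] H K M n :=
  Cohomology.map (transferCochain K p) (coboundary_transferCochain hp) n

/-- Already true for cochains: each of the `N` lifts of `σ` contributes `a σ`. -/
lemma transfer_pullback (hp : IsCoveringMap p) {N : ℕ}
    (hN : ∀ n (σ : SingularSimplex M n), Fintype.card (Lifts p σ) = N) (n : ℕ) (x : H K M n) :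
    transfer K hp n (pullback K p n x) = (N : K) • x := by
  refine Cohomology.map_comp_eq_smul _ _ _ _ _ (fun n a => ?_) n x
  funext σ
  change ∑ τ : Lifts p σ, a (p.comp τ.1) = N * a σ
  rw [Finset.sum_congr rfl fun τ _ => congrArg a τ.2]
  simp [hN]

/-- The projection formula. -/
lemma transfer_cup_pullback (hp : IsCoveringMap p) {k l n : ℕ} (h : k + l = n) (x : H K F k)
    (α : H K M l) :
    transfer K hp n (cup h x (pullback K p l α)) = cup h (transfer K hp k x) α := by
  obtain ⟨a, rfl⟩ := Submodule.Quotient.mk_surjective _ x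
  obtain ⟨b, rfl⟩ := Submodule.Quotient.mk_surjective _ α
  refine congrArg Submodule.Quotient.mk (Subtype.ext (funext fun σ => ?_))
  change ∑ τ : Lifts p σ, a.1 (τ.1.reindex (frontVertex h)) *
      b.1 (p.comp (τ.1.reindex (backVertex h))) =
    transferCochain K p k a.1 (σ.reindex (frontVertex h)) * b.1 (σ.reindex (backVertex h))
  -- Lifts of the front face are the front faces of lifts of `σ`, while the back faces of all these
  -- lifts have the same projection, so the factor `b` is common.
  rw [transferCochain_reindex hp, Finset.sum_mul]
  refine Finset.sum_congr rfl fun τ _ => ?_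
  exact congrArg (_ * b.1 ·) (τ.reindex σ (backVertex h)).2

omit [∀ n (σ : SingularSimplex M n), Fintype (Lifts p σ)] in
lemma pullback_cup {k l n : ℕ} (h : k + l = n) (x : H K M k) (y : H K M l) :
    cup h (pullback K p k x) (pullback K p l y) = pullback K p n (cup h x y) := by
  obtain ⟨a, rfl⟩ := Submodule.Quotient.mk_surjective _ x
  obtain ⟨b, rfl⟩ := Submodule.Quotient.mk_surjective _ y
  rfl

lemma pullback_mem_resonanceVariety [CharZero K] (hp : IsCoveringMap p) {N : ℕ}
    (hN : ∀ n (σ : SingularSimplex M n), Fintype.card (Lifts p σ) = N) (hN0 : N ≠ 0) {i m : ℕ}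
    {α : H K M 1} (hα : α ∈ resonanceVariety K M i m) :
    pullback K p 1 α ∈ resonanceVariety K F i m :=
  natCast_le_rank_cohomology (d := rightMul α) (d' := rightMul (pullback K p 1 α))
    (pullback K p) (fun _ x => pullback_cup rfl x α)
    (transfer K hp) (fun _ x => (transfer_cup_pullback hp rfl x α).symm)
    (Nat.cast_ne_zero.mpr hN0) (transfer_pullback hp hN) hα

end Transfer

end JumpLoci

end
noncomputable section

namespace JumpLoci

/-! ## Transfer in cohomology with local coefficients -/

section TwistedTransfer

open Path.Homotopic

variable {F M : Type*} [TopologicalSpace F] [TopologicalSpace M] {K : Type*} [Field K]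
  {p : C(F, M)} {y₀ : F}

lemma _root_.Path.Homotopic.Quotient.map_trans {X Y : Type*} [TopologicalSpace X]
    [TopologicalSpace Y] (f : C(X, Y)) {x y z : X} (γ : Path.Homotopic.Quotient x y)
    (γ' : Path.Homotopic.Quotient y z) :
    (γ.trans γ').map f = (γ.map f).trans (γ'.map f) := by
  induction γ, γ' using Path.Homotopic.Quotient.ind₂ with | mk a b =>
  rw [← Quotient.mk_trans, ← Quotient.mk_map, Path.map_trans]
  rfl

/-- Sections over `F` of the local system of `ρ`: the functions on classes of paths from `y₀` to
`y` that are equivariant for the pulled back character. -/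
def IsEquivariant (ρ : FundamentalGroup M (p y₀) →* Kˣ) {y : F}
    (f : Path.Homotopic.Quotient y₀ y → K) : Prop :=
  ∀ (δ : Path.Homotopic.Quotient y₀ y₀) (η : Path.Homotopic.Quotient y₀ y),
    f (δ.trans η) = (characterPullback K p y₀ ρ (FundamentalGroup.fromPath δ) : K) * f η

open Classical in
/-- The `ρ`-equivariant extension of an equivariant function on classes of paths in `F` to
classes of paths in `M`; it is zero if `y` is not joined to the base point. -/
def extend (ρ : FundamentalGroup M (p y₀) →* Kˣ) {y : F} (f : Path.Homotopic.Quotient y₀ y → K)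
    (γ : Path.Homotopic.Quotient (p y₀) (p y)) : K :=
  if h : Nonempty (Path.Homotopic.Quotient y₀ y) then
    (ρ (FundamentalGroup.fromPath (γ.trans (h.some.map p).symm)) : K) * f h.some else 0

variable {ρ : FundamentalGroup M (p y₀) →* Kˣ}

lemma character_fromPath_trans (δ ε : Path.Homotopic.Quotient (p y₀) (p y₀)) :
    (ρ (FundamentalGroup.fromPath (δ.trans ε)) : K) =
      ρ (FundamentalGroup.fromPath δ) * ρ (FundamentalGroup.fromPath ε) := by
  -- Multiplication in the fundamental group reverses concatenation; this is harmless since `K` is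
  -- commutative.
  have : FundamentalGroup.fromPath (δ.trans ε) =
    FundamentalGroup.fromPath ε * FundamentalGroup.fromPath δ := rfl
  rw [this, map_mul, Units.val_mul, mul_comm]

lemma extend_of_isEmpty {y : F} (h : IsEmpty (Path.Homotopic.Quotient y₀ y))
    (f : Path.Homotopic.Quotient y₀ y → K) (γ : Path.Homotopic.Quotient (p y₀) (p y)) :
    extend ρ f γ = 0 :=
  dif_neg (not_nonempty_iff.mpr h)

/-- Independence of the chosen path: two choices differ by a loop at `y₀`, and the value of `ρ` on
its image is exactly what turns `f h.some` into `f η`. -/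
lemma extend_eq {y : F} {f : Path.Homotopic.Quotient y₀ y → K} (hf : IsEquivariant ρ f)
    (γ : Path.Homotopic.Quotient (p y₀) (p y)) (η : Path.Homotopic.Quotient y₀ y) :
    extend ρ f γ = (ρ (FundamentalGroup.fromPath (γ.trans (η.map p).symm)) : K) * f η := by
  have h : Nonempty (Path.Homotopic.Quotient y₀ y) := ⟨η⟩
  have e1 : (η.trans h.some.symm).trans h.some = η := by
    rw [Quotient.trans_assoc, Quotient.symm_trans, Quotient.trans_refl]
  have e2 : γ.trans (h.some.map p).symm =
      (γ.trans (η.map p).symm).trans ((η.trans h.some.symm).map p) := by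
    have : ((h.some.symm).map p) = (h.some.map p).symm := by
      induction h.some using Path.Homotopic.Quotient.ind with | mk a => rfl
    rw [Quotient.map_trans, this, Quotient.trans_assoc, ← Quotient.trans_assoc (η.map p).symm,
      Quotient.symm_trans, Quotient.refl_trans]
  rw [extend, dif_pos h, e2, character_fromPath_trans, mul_assoc]
  congr 1
  conv_rhs => rw [← e1]
  exact (hf (η.trans h.some.symm) h.some).symm

/-- Both sides use the same chosen path to `y`, so equivariance of `f` is not needed. -/
lemma extend_trans {y : F} (f : Path.Homotopic.Quotient y₀ y → K)
    (δ : Path.Homotopic.Quotient (p y₀) (p y₀)) (γ : Path.Homotopic.Quotient (p y₀) (p y)) :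
    extend ρ f (δ.trans γ) = (ρ (FundamentalGroup.fromPath δ) : K) * extend ρ f γ := by
  unfold extend
  split_ifs with h
  · rw [Quotient.trans_assoc, character_fromPath_trans, mul_assoc]
  · rw [mul_zero]

lemma extend_add {y : F} (f g : Path.Homotopic.Quotient y₀ y → K)
    (γ : Path.Homotopic.Quotient (p y₀) (p y)) :
    extend ρ (f + g) γ = extend ρ f γ + extend ρ g γ := by
  unfold extend
  split_ifs <;> simp [mul_add]

lemma extend_smul {y : F} (r : K) (f : Path.Homotopic.Quotient y₀ y → K)
    (γ : Path.Homotopic.Quotient (p y₀) (p y)) : extend ρ (r • f) γ = r * extend ρ f γ := by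
  unfold extend
  split_ifs <;> simp [mul_left_comm]

lemma extend_sum {ι : Type*} (s : Finset ι) {y : F} (f : ι → Path.Homotopic.Quotient y₀ y → K)
    (γ : Path.Homotopic.Quotient (p y₀) (p y)) :
    extend ρ (fun η => ∑ i ∈ s, f i η) γ = ∑ i ∈ s, extend ρ (f i) γ := by
  unfold extend
  split_ifs <;> simp [Finset.mul_sum]

/-- The extension is compatible with parallel transport. -/
lemma extend_comp_trans {y z : F} {f : Path.Homotopic.Quotient y₀ z → K} (hf : IsEquivariant ρ f)
    (ε : Path.Homotopic.Quotient y z) (γ : Path.Homotopic.Quotient (p y₀) (p y)) :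
    extend ρ (fun η => f (η.trans ε)) γ = extend ρ f (γ.trans (ε.map p)) := by
  by_cases h : Nonempty (Path.Homotopic.Quotient y₀ y)
  · obtain ⟨η⟩ := h
    have hf' : IsEquivariant ρ fun η : Path.Homotopic.Quotient y₀ y => f (η.trans ε) :=
      fun δ η => (congrArg f (Quotient.trans_assoc δ η ε)).trans (hf δ (η.trans ε))
    -- The paths `η` and `η · ε` are used to compute the two sides; the image of `ε` then cancels.
    rw [extend_eq hf' γ η, extend_eq hf _ (η.trans ε), Quotient.map_trans]
    have : ((η.map p).trans (ε.map p)).symm = (ε.map p).symm.trans (η.map p).symm := by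
      generalize η.map p = a
      generalize ε.map p = b
      induction a, b using Path.Homotopic.Quotient.ind₂ with | mk a b =>
      simp only [← Quotient.mk_trans, ← Quotient.mk_symm, Path.trans_symm]
    rw [this, Quotient.trans_assoc γ, ← Quotient.trans_assoc (ε.map p), Quotient.trans_symm,
      Quotient.refl_trans]
  -- Since `ε` joins `y` to `z`, neither point is reachable from `y₀`, and both sides vanish.
  · rw [extend_of_isEmpty (not_nonempty_iff.mp h), extend_of_isEmpty]
    exact ⟨fun η => h ⟨η.trans ε.symm⟩⟩

/-- Equivariance moves the factor `ρ` into the argument of `f`, where the chosen path cancels. -/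
lemma extend_comp_map {y : F} {f : Path.Homotopic.Quotient (p y₀) (p y) → K}
    (hf : ∀ (δ : Path.Homotopic.Quotient (p y₀) (p y₀)) γ,
      f (δ.trans γ) = (ρ (FundamentalGroup.fromPath δ) : K) * f γ)
    (h : Nonempty (Path.Homotopic.Quotient y₀ y)) (γ : Path.Homotopic.Quotient (p y₀) (p y)) :
    extend ρ (fun η => f (η.map p)) γ = f γ := by
  rw [extend, dif_pos h, ← hf, Quotient.trans_assoc, Quotient.symm_trans, Quotient.trans_refl]

lemma isEquivariant_twistedCochain {n : ℕ}
    (c : twistedCochains (characterPullback K p y₀ ρ) n) (τ : SingularSimplex F n) :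
    IsEquivariant ρ (c.1 τ) :=
  fun δ η => c.2 τ δ η

variable (ρ) in
/-- Pullback of twisted cochains. -/
def twistedPullback (n : ℕ) :
    twistedCochains ρ n →ₗ[K] twistedCochains (characterPullback K p y₀ ρ) n where
  toFun c := ⟨fun τ η => c.1 (p.comp τ) (η.map p), fun τ δ η =>
    (congrArg (c.1 (p.comp τ)) (Quotient.map_trans p δ η)).trans
      (c.2 (p.comp τ) (δ.map p) (η.map p))⟩
  map_add' _ _ := rfl
  map_smul' _ _ := rfl

lemma twistedCoboundary_twistedPullback (n : ℕ) (c : twistedCochains ρ n) :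
    twistedCoboundary (characterPullback K p y₀ ρ) n (twistedPullback ρ n c) =
      twistedPullback ρ (n + 1) (twistedCoboundary ρ n c) := by
  refine Subtype.ext (funext fun τ => funext fun η => ?_)
  change ∑ i : Fin (n + 2), (-1 : K) ^ (i : ℕ) * c.1 (p.comp (τ.face i))
      ((η.trans (Path.Homotopic.Quotient.mk (τ.facePath i))).map p) =
    ∑ i : Fin (n + 2), (-1 : K) ^ (i : ℕ) * c.1 (SingularSimplex.face (p.comp τ) i)
      ((η.map p).trans (Path.Homotopic.Quotient.mk (SingularSimplex.facePath (p.comp τ) i)))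
  refine Finset.sum_congr rfl fun i _ => congrArg _ ?_
  exact congrArg (c.1 (p.comp (τ.face i))) (Quotient.map_trans p η _)

variable [∀ n (σ : SingularSimplex M n), Fintype (Lifts p σ)]

variable (ρ) in
/-- The transfer of twisted cochains: sum over all lifts of the equivariant extensions. -/
def twistedTransfer (n : ℕ) :
    twistedCochains (characterPullback K p y₀ ρ) n →ₗ[K] twistedCochains ρ n where
  toFun c := ⟨fun σ γ => ∑ τ : Lifts p σ, extend ρ (c.1 τ.1) (γ.cast rfl (τ.apply_eq _)), by
    intro σ δ γ
    rw [Finset.mul_sum]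
    refine Finset.sum_congr rfl fun τ _ => ?_
    -- Replacing `σ` by `p ∘ τ` makes the endpoints agree definitionally, so the casts disappear.
    obtain ⟨τ, rfl⟩ := τ
    rw [Quotient.cast_rfl_rfl, Quotient.cast_rfl_rfl]
    exact extend_trans (c.1 τ) δ γ⟩
  map_add' a b := by
    refine Subtype.ext (funext fun σ => funext fun γ => ?_)
    change ∑ τ : Lifts p σ, extend ρ (a.1 τ.1 + b.1 τ.1) _ =
      ∑ τ : Lifts p σ, extend ρ (a.1 τ.1) _ + ∑ τ : Lifts p σ, extend ρ (b.1 τ.1) _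
    simp only [extend_add, Finset.sum_add_distrib]
  map_smul' r a := by
    refine Subtype.ext (funext fun σ => funext fun γ => ?_)
    change ∑ τ : Lifts p σ, extend ρ (r • a.1 τ.1) _ =
      r * ∑ τ : Lifts p σ, extend ρ (a.1 τ.1) _
    simp only [extend_smul, Finset.mul_sum]

/-- Both sides become one double sum over faces and lifts of `σ`: lifts of a face come from lifts of
`σ`, and `extend_comp_trans` handles transport to the first vertex. -/
lemma twistedCoboundary_twistedTransfer (hp : IsCoveringMap p) (n : ℕ)
    (c : twistedCochains (characterPullback K p y₀ ρ) n) :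
    twistedCoboundary ρ n (twistedTransfer ρ n c) =
      twistedTransfer ρ (n + 1) (twistedCoboundary (characterPullback K p y₀ ρ) n c) := by
  refine Subtype.ext (funext fun σ => funext fun γ => ?_)
  have face : ∀ i : Fin (n + 2), (twistedTransfer ρ n c).1 (σ.face i)
      (γ.trans (Path.Homotopic.Quotient.mk (σ.facePath i))) =
      ∑ τ : Lifts p σ, extend ρ (fun η => c.1 (τ.1.face i)
        (η.trans (Path.Homotopic.Quotient.mk (τ.1.facePath i))))
          (γ.cast rfl (τ.apply_eq _)) := by
    intro i
    refine (Lifts.sum_reindex hp σ i.succAbove fun τ => extend ρ (c.1 τ.1)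
      ((γ.trans (Path.Homotopic.Quotient.mk (σ.facePath i))).cast rfl (τ.apply_eq _))).trans ?_
    refine Finset.sum_congr rfl fun τ _ => ?_
    obtain ⟨τ, rfl⟩ := τ
    rw [Quotient.cast_rfl_rfl, extend_comp_trans (isEquivariant_twistedCochain c (τ.face i))]
    exact congrArg (extend ρ (c.1 (τ.face i))) (Quotient.cast_rfl_rfl _)
  have expand : ∀ τ : Lifts p σ, extend ρ
      ((twistedCoboundary (characterPullback K p y₀ ρ) n c).1 τ.1) (γ.cast rfl (τ.apply_eq _)) =
      ∑ i : Fin (n + 2), (-1 : K) ^ (i : ℕ) * extend ρ (fun η => c.1 (τ.1.face i)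
        (η.trans (Path.Homotopic.Quotient.mk (τ.1.facePath i)))) (γ.cast rfl (τ.apply_eq _)) := by
    intro τ
    refine (extend_sum Finset.univ (fun (i : Fin (n + 2)) => (-1 : K) ^ (i : ℕ) •
      fun η : Path.Homotopic.Quotient y₀ (τ.1 (vertex 0)) =>
      c.1 (τ.1.face i) (η.trans (Path.Homotopic.Quotient.mk (τ.1.facePath i)))) _).trans ?_
    exact Finset.sum_congr rfl fun i _ => extend_smul _ _ _
  change ∑ i : Fin (n + 2), (-1 : K) ^ (i : ℕ) * (twistedTransfer ρ n c).1 (σ.face i)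
      (γ.trans (Path.Homotopic.Quotient.mk (σ.facePath i))) =
    ∑ τ : Lifts p σ, extend ρ
      ((twistedCoboundary (characterPullback K p y₀ ρ) n c).1 τ.1) (γ.cast rfl (τ.apply_eq _))
  simp only [face, expand, Finset.mul_sum]
  exact Finset.sum_comm

open Classical in
/-- The number of elements of the deck group that preserve the path component of `y₀`. -/
def componentStabilizerCard (G : Type*) [Group G] [MulAction G F] [Fintype G] (y₀ : F) : ℕ :=
  {g : G | Joined y₀ (g • y₀)}.toFinset.card

lemma componentStabilizerCard_ne_zero (G : Type*) [Group G] [MulAction G F] [Fintype G]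
    (y₀ : F) : componentStabilizerCard G y₀ ≠ 0 :=
  Finset.card_ne_zero_of_mem (a := 1) (by simp [Joined.refl])

lemma nonempty_quotient_iff_joined {X : Type*} [TopologicalSpace X] {x y : X} :
    Nonempty (Path.Homotopic.Quotient x y) ↔ Joined x y :=
  ⟨fun ⟨γ⟩ => by induction γ using Path.Homotopic.Quotient.ind with | mk a => exact ⟨a⟩,
    fun ⟨a⟩ => ⟨Path.Homotopic.Quotient.mk a⟩⟩

lemma joined_smul_iff {G : Type*} [Group G] [MulAction G F] [ContinuousConstSMul G F] {x y : F}
    (h : Joined x y) (g : G) : Joined x (g • y) ↔ Joined x (g • x) := by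
  have : Joined (g • x) (g • y) :=
    h.map (continuous_const_smul g)
  exact ⟨fun h' => h'.trans this.symm, fun h' => h'.trans this⟩

/-- Each lift of `σ` whose first vertex is reachable from `y₀` contributes `c σ γ`, and the others
contribute zero; it remains to count the former. -/
lemma twistedTransfer_twistedPullback {G : Type*} [Group G] [MulAction G F] [Fintype G]
    (hp : IsQuotientCoveringMap p G) (n : ℕ) (c : twistedCochains ρ n) :
    twistedTransfer ρ n (twistedPullback ρ n c) = (componentStabilizerCard G y₀ : K) • c := by
  classical
  have := hp.toContinuousConstSMul
  refine Subtype.ext (funext fun σ => funext fun γ => ?_)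
  -- The endpoint of the lift of `γ` from `y₀` lies in the path component of `y₀`. With `e` as
  -- origin of the fibre, the lift labelled by `g` starts at `g • e`, which is reachable exactly
  -- when `g • y₀` is.
  let e := hp.isCoveringMap.monodromy γ ⟨y₀, rfl⟩
  have he : Joined y₀ e :=
    nonempty_quotient_iff_joined.mp ⟨hp.isCoveringMap.liftPathQuotient γ ⟨y₀, rfl⟩⟩
  have key : ∀ τ : Lifts p σ,
      extend ρ ((twistedPullback ρ n c).1 τ.1) (γ.cast rfl (τ.apply_eq _)) =
        if Joined y₀ (Lifts.equivGroup hp σ e τ • y₀) then c.1 σ γ else 0 := by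
    intro τ
    rw [← joined_smul_iff he, Lifts.equivGroup_smul, ← nonempty_quotient_iff_joined]
    clear_value e
    obtain ⟨τ, rfl⟩ := τ
    rw [Quotient.cast_rfl_rfl]
    split_ifs with h
    · exact extend_comp_map (c.2 (p.comp τ)) h γ
    · exact extend_of_isEmpty (not_nonempty_iff.mp h) _ γ
  change ∑ τ : Lifts p σ, extend ρ ((twistedPullback ρ n c).1 τ.1) (γ.cast rfl (τ.apply_eq _)) =
    (componentStabilizerCard G y₀ : K) * c.1 σ γ
  rw [Finset.sum_congr rfl fun τ _ => key τ, (Lifts.equivGroup hp σ e).sum_comp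
    fun g => if Joined y₀ (g • y₀) then c.1 σ γ else 0, ← Finset.sum_filter, Finset.sum_const,
    nsmul_eq_mul, componentStabilizerCard]
  congr 3
  ext g
  simp

lemma characterPullback_mem_characteristicVariety [CharZero K] {G : Type*} [Group G]
    [MulAction G F] [Fintype G] (hp : IsQuotientCoveringMap p G) {i m : ℕ}
    (hρ : ρ ∈ characteristicVariety K (p y₀) i m) :
    characterPullback K p y₀ ρ ∈ characteristicVariety K y₀ i m :=
  natCast_le_rank_cohomology (twistedPullback ρ) twistedCoboundary_twistedPullback
    (twistedTransfer ρ) (twistedCoboundary_twistedTransfer hp.isCoveringMap)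
    (Nat.cast_ne_zero.mpr (componentStabilizerCard_ne_zero G y₀))
    (twistedTransfer_twistedPullback hp) hρ

end TwistedTransfer

end JumpLoci

end

/-! ### The inclusions of jump loci -/

theorem proposition2p1
    {M : Type*} [TopologicalSpace M] [T2Space M] [Topology.CWComplex (Set.univ : Set M)]
    (hM : ∀ n ≤ 1, Finite (Topology.RelCWComplex.cell (Set.univ : Set M) n))
    {F : Type*} [TopologicalSpace F] [ConnectedSpace F]
    {G : Type*} [Group G] [Finite G] [MulAction G F]
    (p : C(F, M)) (hp : IsQuotientCoveringMap p G)
    (K : Type*) [Field K] [CharZero K] (i m : ℕ) (hm : 0 < m) :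
    (∀ y₀ : F, JumpLoci.characterPullback K p y₀ '' JumpLoci.characteristicVariety K (p y₀) i m ⊆
      JumpLoci.characteristicVariety K y₀ i m) ∧
    JumpLoci.pullback K p 1 '' JumpLoci.resonanceVariety K M i m ⊆ JumpLoci.resonanceVariety K F i m := by
  have := Fintype.ofFinite G
  have cov := hp.isCoveringMap
  -- Surjectivity of `p` supplies an origin in each fibre, so every simplex has exactly as many
  -- lifts as `G` has elements.
  have fib : ∀ n (σ : JumpLoci.SingularSimplex M n), Nonempty (JumpLoci.Lifts p σ ≃ G) :=
    fun n σ => by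
      obtain ⟨y, hy⟩ := hp.surjective (σ (JumpLoci.vertex 0))
      exact ⟨JumpLoci.Lifts.equivGroup hp σ ⟨y, hy⟩⟩
  let (n : ℕ) (σ : JumpLoci.SingularSimplex M n) : Fintype (JumpLoci.Lifts p σ) :=
    Fintype.ofEquiv G (fib n σ).some.symm
  constructor
  · rintro y₀ _ ⟨ρ, hρ, rfl⟩
    exact JumpLoci.characterPullback_mem_characteristicVariety hp hρ
  · rintro _ ⟨α, hα, rfl⟩
    exact JumpLoci.pullback_mem_resonanceVariety cov
      (fun n σ => Fintype.card_congr (fib n σ).some) Fintype.card_ne_zero hα
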